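/- Let $p>1$, let $(X,d)$ be a locally compact separable metric space and $m$ a positive Radon measure on $X$ with full support. Write $C_c(X)$ for the continuous real functions on $X$ with compact support. Let $(\mathcal{E},\mathcal{F})$ be a *$p$-energy* on $(X,d,m)$: $\mathcal{F}$ is a dense subspace of $L^p(X;m)$ and $\mathcal{E}:\mathcal{F}\to[0,+\infty)$ satisfies 1. $\mathcal{E}^{1/p}$ is a semi-norm on $\mathcal{F}$; 2. $(\mathcal{F},\mathcal{E}(\cdot)^{1/p}+\|\cdot\|_{L^p(X;m)})$ is a Banach space; 3. if $\varphi:\mathbb{R}\to\mathbb{R}$ satisfies $\varphi(0)=0$ and $|\varphi(t)-\varphi(s)|\le|t-s|$ for all $t,s\in\mathbb{R}$, then $\varphi(f)\in\mathcal{F}$ and $\mathcal{E}(\varphi(f))\le\mathcal{E}(f)$ for every $f\in\mathcal{F}$; 4. $\mathcal{F}\cap C_c(X)$ is uniformly dense in $C_c(X)$ and $(\mathcal{E}(\cdot)^{1/p}+\|\cdot\|_{L^p(X;m)})$-dense in $\mathcal{F}$; 5. $\mathcal{E}(f+g)=\mathcal{E}(f)+\mathcal{E}(g)$ whenever $f,g\in\mathcal{F}$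 have compact support and $g$ is constant ($m$-a.e.) in an open neighborhood of $\mathrm{supp}(f)$, where $\mathrm{supp}(f)$ is the support of the measure $|f|\,\mathrm{d}m$; 6. for all $f,g\in\mathcal{F}$, $\mathcal{E}(f+g)+\mathcal{E}(f-g)\ge 2\big(\mathcal{E}(f)^{\frac1{p-1}}+\mathcal{E}(g)^{\frac1{p-1}}\big)^{p-1}$ if $p\in(1,2]$, and the reverse inequality holds if $p\in[2,+\infty)$. Let $\Gamma$ be a *$p$-energy measure* of $(\mathcal{E},\mathcal{F})$, that is, a map assigning to each $f\in\mathcal{F}$ a Borel measure $\Gamma(f)$ on $X$ such that 1. for every $f\in\mathcal{F}$, $\Gamma(f)$ is a positive Radon measure with $\Gamma(f)(X)=\mathcal{E}(f)$; 2. for every Borel set $A\subseteq X$, $\Gamma(\cdot)(A)^{1/p}$ is a semi-norm on $\mathcal{F}$; 3. if $f,g\in\mathcal{F}\cap C_c(X)$, $A\subseteq X$ is Borel and $f-g$ is constant on $A$, then $\Gamma(f)(A)=\Gamma(g)(A)$; 4. for all $f,g\in\mathcal{F}$ and every Borel set $A\subseteq X$, the inequalities in 6. above hold with $\Gamma(\cdot)(A)$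 in place of $\mathcal{E}(\cdot)$; 5. if $f\in\mathcal{F}\cap C_c(X)$, $\varphi:\mathbb{R}\to\mathbb{R}$ is continuous and piecewise $C^1$ (finitely many pieces), and $\varphi(f)\in\mathcal{F}$, then $\mathrm{d}\Gamma(\varphi(f))=|\varphi'(f)|^p\,\mathrm{d}\Gamma(f)$. For $u\in\mathcal{F}$ put $\mathcal{E}_1(u)=\mathcal{E}(u)+\|u\|^p_{L^p(X;m)}$. For an open set $B\subseteq X$ let $$\mathrm{cap}_1(B)=\inf\{\mathcal{E}_1(u):u\in\mathcal{F},\ u\ge1\ m\text{-a.e. on }B\}\qquad(\inf\emptyset=+\infty),$$ and for an arbitrary subset $A\subseteq X$ let $\mathrm{cap}_1(A)=\inf\{\mathrm{cap}_1(B):B\text{ open},\ A\subseteq B\}$. **Proposition 8.11.** For any $u\in\mathcal{F}$, the measure $\Gamma(u)$ charges no set of zero capacity: for any subset $A\subseteq X$, $\mathrm{cap}_1(A)=0$ implies $\Gamma(u)(A)=0$ (that is, $A$ is contained in a Borel set of $\Gamma(u)$-measure zero). -/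

import Mathlib

open MeasureTheory

open scoped ENNReal

noncomputable section

/-- A continuous function with compact support (an element of `C_c(X)`). -/
def IsCc {X : Type*} [TopologicalSpace X] (v : X → ℝ) : Prop :=
  Continuous v ∧ HasCompactSupport v

/-- The class `f ∈ L^p(X; m)` belongs to `C_c(X)` and `v` is its continuous compactly supported
version (unique when `m` has full support). -/
def IsCcVersion {X : Type*} [TopologicalSpace X] [MeasurableSpace X] {q : ℝ≥0∞} {m : Measure X}
    (f : Lp ℝ q m) (v : X → ℝ) : Prop :=
  IsCc v ∧ f =ᵐ[m] v

/-- The support of `f ∈ L^p(X; m)`, that is, the support of the measure `|f| dm`. -/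
def lpSupport {X : Type*} [TopologicalSpace X] [MeasurableSpace X] {q : ℝ≥0∞} {m : Measure X}
    (f : Lp ℝ q m) : Set X :=
  (m.withDensity fun x => ENNReal.ofReal |f x|).support

/-- A piecewise `C¹` function on the line: it is continuous, and after removing finitely many
break points it is `C¹` on every piece up to and including the end points. -/
def IsPiecewiseC1 (φ : ℝ → ℝ) : Prop :=
  Continuous φ ∧ ∃ S : Finset ℝ, ∀ a b : ℝ, a < b → (∀ s ∈ S, s ∉ Set.Ioo a b) →
    ContDiffOn ℝ 1 φ (Set.Icc a b)

/-- A `p`-energy `(𝓔, 𝓕)` on `(X, d, m)`. -/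
structure PEnergy {X : Type*} [TopologicalSpace X] [MeasurableSpace X] (p : ℝ)
    (m : Measure X) where
  /-- the domain `𝓕`, a subspace of `L^p(X; m)` -/
  domain : Submodule ℝ (Lp ℝ (ENNReal.ofReal p) m)
  /-- the functional `𝓔` on `𝓕` -/
  energy : domain → ℝ
  /-- `𝓕` is dense in `L^p(X; m)` -/
  dense_domain : ∀ f : Lp ℝ (ENNReal.ofReal p) m, ∀ ε > 0, ∃ g : domain,
    ‖f - (g : Lp ℝ (ENNReal.ofReal p) m)‖ < ε
  /-- `𝓔^{1/p}` is a semi-norm -/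
  energy_nonneg : ∀ f : domain, 0 ≤ energy f
  energy_smul : ∀ (c : ℝ) (f : domain), energy (c • f) ^ (1 / p) = |c| * energy f ^ (1 / p)
  energy_add_le : ∀ f g : domain,
    energy (f + g) ^ (1 / p) ≤ energy f ^ (1 / p) + energy g ^ (1 / p)
  /-- closed property: `𝓕` is complete for the norm `𝓔^{1/p} + ‖·‖_{L^p}` -/
  complete : ∀ f : ℕ → domain,
    (∀ ε > 0, ∃ N : ℕ, ∀ k ≥ N, ∀ l ≥ N, energy (f k - f l) ^ (1 / p)
      + ‖(f k : Lp ℝ (ENNReal.ofReal p) m) - (f l : Lp ℝ (ENNReal.ofReal p) m)‖ < ε) →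
    ∃ g : domain, ∀ ε > 0, ∃ N : ℕ, ∀ k ≥ N, energy (f k - g) ^ (1 / p)
      + ‖(f k : Lp ℝ (ENNReal.ofReal p) m) - (g : Lp ℝ (ENNReal.ofReal p) m)‖ < ε
  /-- Markovian property -/
  markov : ∀ (φ : ℝ → ℝ) (h0 : φ 0 = 0) (hφ : LipschitzWith 1 φ) (f : domain),
    ∃ h : hφ.compLp h0 (f : Lp ℝ (ENNReal.ofReal p) m) ∈ domain, energy ⟨_, h⟩ ≤ energy f
  /-- regular property: `𝓕 ∩ C_c(X)` is uniformly dense in `C_c(X)` -/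
  regular_uniform : ∀ u : X → ℝ, IsCc u → ∀ ε > 0, ∃ (f : domain) (v : X → ℝ),
    IsCcVersion (f : Lp ℝ (ENNReal.ofReal p) m) v ∧ ∀ x, |u x - v x| ≤ ε
  /-- regular property: `𝓕 ∩ C_c(X)` is dense in `𝓕` for `𝓔^{1/p} + ‖·‖_{L^p}` -/
  regular_energy : ∀ f : domain, ∀ ε > 0, ∃ (g : domain) (v : X → ℝ),
    IsCcVersion (g : Lp ℝ (ENNReal.ofReal p) m) v ∧ energy (f - g) ^ (1 / p)
      + ‖(f : Lp ℝ (ENNReal.ofReal p) m) - (g : Lp ℝ (ENNReal.ofReal p) m)‖ < ε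
  /-- strongly local property -/
  strongly_local : ∀ f g : domain,
    IsCompact (lpSupport (f : Lp ℝ (ENNReal.ofReal p) m)) →
    IsCompact (lpSupport (g : Lp ℝ (ENNReal.ofReal p) m)) →
    (∃ U : Set X, IsOpen U ∧ lpSupport (f : Lp ℝ (ENNReal.ofReal p) m) ⊆ U ∧
      ∃ c : ℝ, ∀ᵐ x ∂m, x ∈ U → (g : Lp ℝ (ENNReal.ofReal p) m) x = c) →
    energy (f + g) = energy f + energy g
  /-- `p`-Clarkson's inequality for `p ≤ 2` -/
  clarkson_le_two : p ≤ 2 → ∀ f g : domain,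
    2 * (energy f ^ (1 / (p - 1)) + energy g ^ (1 / (p - 1))) ^ (p - 1)
      ≤ energy (f + g) + energy (f - g)
  /-- `p`-Clarkson's inequality for `2 ≤ p` -/
  clarkson_two_le : 2 ≤ p → ∀ f g : domain,
    energy (f + g) + energy (f - g)
      ≤ 2 * (energy f ^ (1 / (p - 1)) + energy g ^ (1 / (p - 1))) ^ (p - 1)

/-- `Γ` is a `p`-energy measure of the `p`-energy `(𝓔, 𝓕)`. -/
structure PEnergy.IsEnergyMeasure {X : Type*} [TopologicalSpace X] [MeasurableSpace X] {p : ℝ}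
    {m : Measure X} (𝓔 : PEnergy p m) (Γ : 𝓔.domain → Measure X) : Prop where
  /-- `Γ(f)` is a Radon measure of total mass `𝓔(f)` -/
  regular : ∀ f, (Γ f).Regular
  total_mass : ∀ f, Γ f Set.univ = ENNReal.ofReal (𝓔.energy f)
  /-- `Γ(·)(A)^{1/p}` is a semi-norm (non-negativity is automatic) -/
  smul : ∀ A : Set X, MeasurableSet A → ∀ (c : ℝ) (f : 𝓔.domain),
    (Γ (c • f)).real A ^ (1 / p) = |c| * (Γ f).real A ^ (1 / p)
  add_le : ∀ A : Set X, MeasurableSet A → ∀ f g : 𝓔.domain,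
    (Γ (f + g)).real A ^ (1 / p) ≤ (Γ f).real A ^ (1 / p) + (Γ g).real A ^ (1 / p)
  /-- locality: if `f - g` is constant on `A`, where `f, g ∈ 𝓕 ∩ C_c(X)`, then
  `Γ(f)(A) = Γ(g)(A)` -/
  locality : ∀ (f g : 𝓔.domain) (u v : X → ℝ),
    IsCcVersion (f : Lp ℝ (ENNReal.ofReal p) m) u →
    IsCcVersion (g : Lp ℝ (ENNReal.ofReal p) m) v →
    ∀ A : Set X, MeasurableSet A → (∃ c : ℝ, ∀ x ∈ A, u x - v x = c) → Γ f A = Γ g A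
  /-- `p`-Clarkson's inequality for `p ≤ 2` -/
  clarkson_le_two : p ≤ 2 → ∀ (f g : 𝓔.domain) (A : Set X), MeasurableSet A →
    2 * ((Γ f).real A ^ (1 / (p - 1)) + (Γ g).real A ^ (1 / (p - 1))) ^ (p - 1)
      ≤ (Γ (f + g)).real A + (Γ (f - g)).real A
  /-- `p`-Clarkson's inequality for `2 ≤ p` -/
  clarkson_two_le : 2 ≤ p → ∀ (f g : 𝓔.domain) (A : Set X), MeasurableSet A →
    (Γ (f + g)).real A + (Γ (f - g)).real A
      ≤ 2 * ((Γ f).real A ^ (1 / (p - 1)) + (Γ g).real A ^ (1 / (p - 1))) ^ (p - 1)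
  /-- chain rule `dΓ(φ(f)) = |φ'(f)|^p dΓ(f)` for `f ∈ 𝓕 ∩ C_c(X)` and piecewise `C¹` functions
  `φ`, whenever `φ(f) ∈ 𝓕` (automatic if `φ(0) = 0`). The value of `φ'` at the break points is
  irrelevant, because by locality `Γ(f)` does not charge level sets of `f`. -/
  chain_rule : ∀ (f : 𝓔.domain) (u : X → ℝ), IsCcVersion (f : Lp ℝ (ENNReal.ofReal p) m) u →
    ∀ φ : ℝ → ℝ, IsPiecewiseC1 φ → ∀ g : 𝓔.domain,
      (g : Lp ℝ (ENNReal.ofReal p) m) =ᵐ[m] (fun x => φ (u x)) →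
      Γ g = (Γ f).withDensity fun x => ENNReal.ofReal (|deriv φ (u x)| ^ p)

/-- `𝓔₁(u) = 𝓔(u) + ‖u‖_{L^p(X; m)}^p`. -/
def PEnergy.energyOne {X : Type*} [TopologicalSpace X] [MeasurableSpace X] {p : ℝ}
    {m : Measure X} (𝓔 : PEnergy p m) (u : 𝓔.domain) : ℝ :=
  𝓔.energy u + ‖(u : Lp ℝ (ENNReal.ofReal p) m)‖ ^ p

/-- The capacity of an open set `B`, the infimum of `𝓔₁(u)` over all `u ∈ 𝓕` with `u ≥ 1`
`m`-a.e. on `B`; it is `∞` if there is no such `u`. -/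
def PEnergy.capOneOpen {X : Type*} [TopologicalSpace X] [MeasurableSpace X] {p : ℝ}
    {m : Measure X} (𝓔 : PEnergy p m) (B : Set X) : ℝ≥0∞ :=
  ⨅ (u : 𝓔.domain) (_ : ∀ᵐ x ∂m, x ∈ B → 1 ≤ (u : Lp ℝ (ENNReal.ofReal p) m) x),
    ENNReal.ofReal (𝓔.energyOne u)

/-- The capacity `cap₁(A)` of an arbitrary set `A`. -/
def PEnergy.capOne {X : Type*} [TopologicalSpace X] [MeasurableSpace X] {p : ℝ}
    {m : Measure X} (𝓔 : PEnergy p m) (A : Set X) : ℝ≥0∞ :=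
  ⨅ (B : Set X) (_ : IsOpen B) (_ : A ⊆ B), 𝓔.capOneOpen B

end

/-! Inner regularity of the finite measure `Γ u`, after enlarging the given set to a Borel one of
zero capacity, reduces the claim to a compact `K` of zero capacity. If `w ∈ 𝓕 ∩ C_c(X)` vanishes on
`K`, locality compares it with `0` and gives `Γ(w)(K) = 0`. Since `Γ(·)(K)^{1/p}` is a semi-norm
dominated by `𝓔^{1/p}`, it is enough that such `w` are `𝓔^{1/p}`-dense in `𝓕`.

For `v ∈ 𝓕 ∩ C_c(X)`, zero capacity yields `h ∈ 𝓕 ∩ C_c(X)` of small norm with `h ≥ 1/2` on `K`.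
Then `(v - M h)⁺ - (-v - M h)⁺`, with `M ≥ 2 sup |v|`, vanishes on `K` and is `L^p`-close to `v`.
The Markov property bounds its energy, but does not control the energy of its difference from `v`.
This gap is closed by `exists_mem_seminorm_add_norm_lt`: Clarkson's inequality makes the energy
uniformly convex, so `L^p`-convergence with bounded energy becomes norm convergence within a
midpoint convex set. The same lemma produces `h` (`exists_ccVersion_of_one_le`), where continuous
functions must stay at least `1/2` on `K`. -/

open Filter Topology

/-! ### The energy semi-norm and its uniform convexity -/

namespace PEnergy

variable {X : Type*} [TopologicalSpace X] [MeasurableSpace X] {p : ℝ} {m : Measure X}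
  (𝓔 : PEnergy p m)

/-- The energy semi-norm `𝓔^{1/p}`. -/
noncomputable def seminorm (f : 𝓔.domain) : ℝ := 𝓔.energy f ^ (1 / p)

lemma seminorm_nonneg (f : 𝓔.domain) : 0 ≤ 𝓔.seminorm f :=
  Real.rpow_nonneg (𝓔.energy_nonneg f) _

lemma seminorm_smul (c : ℝ) (f : 𝓔.domain) : 𝓔.seminorm (c • f) = |c| * 𝓔.seminorm f :=
  𝓔.energy_smul c f

lemma seminorm_add_le (f g : 𝓔.domain) :
    𝓔.seminorm (f + g) ≤ 𝓔.seminorm f + 𝓔.seminorm g :=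
  𝓔.energy_add_le f g

lemma seminorm_neg (f : 𝓔.domain) : 𝓔.seminorm (-f) = 𝓔.seminorm f := by
  have := 𝓔.seminorm_smul (-1) f
  simpa using this

lemma seminorm_sub_le (f g : 𝓔.domain) :
    𝓔.seminorm (f - g) ≤ 𝓔.seminorm f + 𝓔.seminorm g := by
  have := 𝓔.seminorm_add_le f (-g)
  rwa [seminorm_neg, ← sub_eq_add_neg] at this

lemma seminorm_rpow (hp : 1 < p) (f : 𝓔.domain) : 𝓔.seminorm f ^ p = 𝓔.energy f := by
  rw [seminorm, ← Real.rpow_mul (𝓔.energy_nonneg f), one_div_mul_cancel (by positivity),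
    Real.rpow_one]

lemma energy_le_rpow (hp : 1 < p) {f : 𝓔.domain} {C : ℝ} (h : 𝓔.seminorm f ≤ C) :
    𝓔.energy f ≤ C ^ p := by
  rw [← 𝓔.seminorm_rpow hp f]
  exact Real.rpow_le_rpow (𝓔.seminorm_nonneg f) h (by positivity)

lemma energy_half_smul (hp : 1 < p) (f : 𝓔.domain) :
    𝓔.energy ((1 / 2 : ℝ) • f) = (1 / 2 : ℝ) ^ p * 𝓔.energy f := by
  rw [← 𝓔.seminorm_rpow hp, ← 𝓔.seminorm_rpow hp f, seminorm_smul,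
    Real.mul_rpow (abs_nonneg _) (𝓔.seminorm_nonneg f), abs_of_pos (by norm_num)]

lemma energy_zero (hp : 1 < p) : 𝓔.energy 0 = 0 := by
  have h := 𝓔.seminorm_smul 0 0
  rw [smul_zero, abs_zero, zero_mul] at h
  rw [← 𝓔.seminorm_rpow hp, h, Real.zero_rpow (by positivity)]

/-- Uniform convexity of the energy, a consequence of Clarkson's inequality. -/
lemma energy_half_sub_le (hp : 1 < p) {x y : 𝓔.domain} {a b : ℝ} (ha : 0 ≤ a)
    (hx : 𝓔.energy x ≤ b) (hy : 𝓔.energy y ≤ b)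
    (hm : a ≤ 𝓔.energy ((1 / 2 : ℝ) • (x + y))) :
    𝓔.energy ((1 / 2 : ℝ) • (x - y)) ≤
      max (b - a) ((b ^ (1 / (p - 1)) - a ^ (1 / (p - 1))) ^ (p - 1)) := by
  have hp1 : 0 < p - 1 := by linarith
  have hb : 0 ≤ b := (𝓔.energy_nonneg x).trans hx
  have hq : 0 < 1 / (p - 1) := by positivity
  have hq1 : 1 / (p - 1) * (p - 1) = 1 := by field_simp
  have inv : ∀ t : ℝ, 0 ≤ t → (t ^ (1 / (p - 1))) ^ (p - 1) = t := fun t ht => by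
    rw [← Real.rpow_mul ht, hq1, Real.rpow_one]
  have inv' : ∀ t : ℝ, 0 ≤ t → (t ^ (p - 1)) ^ (1 / (p - 1)) = t := fun t ht => by
    rw [← Real.rpow_mul ht, mul_comm, hq1, Real.rpow_one]
  rcases le_total p 2 with h2 | h2
  · refine le_max_of_le_right ?_
    -- For `p ≤ 2` Clarkson is applied to the half sum and half difference, so that the energies of
    -- `x` and `y`, at most `2 * b` together, bound the other side.
    have hc := 𝓔.clarkson_le_two h2 ((1 / 2 : ℝ) • (x + y)) ((1 / 2 : ℝ) • (x - y))
    have e1 : (1 / 2 : ℝ) • (x + y) + (1 / 2 : ℝ) • (x - y) = x := by module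
    have e2 : (1 / 2 : ℝ) • (x + y) - (1 / 2 : ℝ) • (x - y) = y := by module
    rw [e1, e2] at hc
    set P := 𝓔.energy ((1 / 2 : ℝ) • (x + y))
    set Q := 𝓔.energy ((1 / 2 : ℝ) • (x - y))
    have hP : 0 ≤ P := 𝓔.energy_nonneg _
    have hQ : 0 ≤ Q := 𝓔.energy_nonneg _
    have h1 : (P ^ (1 / (p - 1)) + Q ^ (1 / (p - 1))) ^ (p - 1) ≤ b := by linarith
    have h3 := Real.rpow_le_rpow (by positivity) h1 hq.le
    rw [inv' _ (by positivity)] at h3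
    have h4 : a ^ (1 / (p - 1)) ≤ P ^ (1 / (p - 1)) := Real.rpow_le_rpow ha hm hq.le
    calc Q = (Q ^ (1 / (p - 1))) ^ (p - 1) := (inv Q hQ).symm
      _ ≤ _ := Real.rpow_le_rpow (by positivity) (by linarith) hp1.le
  · refine le_max_of_le_left ?_
    -- For `2 ≤ p` it is applied to `x / 2` and `y / 2`. The factors `2 ^ (p - 1)` and `2 ^ (-p)`
    -- leave `b / 2` in `h4`, so the energies of the half sum and half difference add up to at most
    -- `b`.
    have hc := 𝓔.clarkson_two_le h2 ((1 / 2 : ℝ) • x) ((1 / 2 : ℝ) • y)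
    rw [← smul_add, ← smul_sub] at hc
    have half : ∀ z, 𝓔.energy z ≤ b → 𝓔.energy ((1 / 2 : ℝ) • z) ^ (1 / (p - 1)) ≤
        ((1 / 2 : ℝ) ^ p * b) ^ (1 / (p - 1)) := fun z hz => by
      rw [𝓔.energy_half_smul hp]
      have := 𝓔.energy_nonneg z
      exact Real.rpow_le_rpow (by positivity) (by gcongr) hq.le
    have h3 : (𝓔.energy ((1 / 2 : ℝ) • x) ^ (1 / (p - 1)) +
        𝓔.energy ((1 / 2 : ℝ) • y) ^ (1 / (p - 1))) ^ (p - 1) ≤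
        (2 * ((1 / 2 : ℝ) ^ p * b) ^ (1 / (p - 1))) ^ (p - 1) := by
      have h5 := Real.rpow_nonneg (𝓔.energy_nonneg ((1 / 2 : ℝ) • x)) (1 / (p - 1))
      have h6 := Real.rpow_nonneg (𝓔.energy_nonneg ((1 / 2 : ℝ) • y)) (1 / (p - 1))
      exact Real.rpow_le_rpow (by positivity) (by linarith [half x hx, half y hy]) hp1.le
    have h4 : (2 * ((1 / 2 : ℝ) ^ p * b) ^ (1 / (p - 1))) ^ (p - 1) = b / 2 := by
      rw [Real.mul_rpow (by norm_num) (by positivity), inv _ (by positivity),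
        Real.rpow_sub_one (by norm_num), ← mul_assoc, div_mul_eq_mul_div,
        ← Real.mul_rpow (by norm_num) (by norm_num)]
      norm_num
      ring
    rw [h4] at h3
    linarith

/-! ### From `L^p`-convergence to convergence in `𝓕` -/

/-- A Mazur type lemma: an `L^p`-limit `f ∈ 𝓕` of elements with bounded energy of a midpoint
convex set is a limit of elements of that set for `𝓔^{1/p} + ‖·‖_{L^p}`. -/
lemma exists_mem_seminorm_add_norm_lt [Fact (1 ≤ ENNReal.ofReal p)] (hp : 1 < p)
    {S : Set 𝓔.domain}
    (hS : ∀ g ∈ S, ∀ h ∈ S, (1 / 2 : ℝ) • (g + h) ∈ S) {C : ℝ} {f : 𝓔.domain}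
    (hf : ∀ ε > 0, ∃ g ∈ S, 𝓔.seminorm g ≤ C ∧
      ‖(g : Lp ℝ (ENNReal.ofReal p) m) - (f : Lp ℝ (ENNReal.ofReal p) m)‖ ≤ ε)
    {ε : ℝ} (hε : 0 < ε) :
    ∃ g ∈ S, 𝓔.seminorm (g - f) +
      ‖(g : Lp ℝ (ENNReal.ofReal p) m) - (f : Lp ℝ (ENNReal.ofReal p) m)‖ < ε := by
  have hp0 : 0 < p := by linarith
  let δ : ℕ → ℝ := fun n => 1 / ((n : ℝ) + 1)
  have hδ : ∀ n, 0 < δ n := fun n => Nat.one_div_pos_of_nat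
  have hδ_anti : ∀ {k n : ℕ}, n ≤ k → δ k ≤ δ n := fun h => Nat.one_div_le_one_div h
  have hδ_lim : Tendsto δ atTop (𝓝 0) := tendsto_one_div_add_atTop_nhds_zero_nat
  -- These sets decrease and are midpoint convex. Their energy infima `a n` increase and are bounded
  -- by `C ^ p`, so near-minimizers of the `T n` form a Cauchy sequence by uniform convexity.
  let T : ℕ → Set 𝓔.domain := fun n => {g | g ∈ S ∧ 𝓔.seminorm g ≤ C ∧
    ‖(g : Lp ℝ (ENNReal.ofReal p) m) - (f : Lp ℝ (ENNReal.ofReal p) m)‖ ≤ δ n}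
  have hT_mid : ∀ n, ∀ g ∈ T n, ∀ h ∈ T n, (1 / 2 : ℝ) • (g + h) ∈ T n := by
    rintro n g ⟨gS, gC, gn⟩ h ⟨hS', hC, hn⟩
    refine ⟨hS g gS h hS', ?_, ?_⟩
    · rw [seminorm_smul, abs_of_pos (by norm_num)]
      linarith [𝓔.seminorm_add_le g h]
    · have e : (((1 / 2 : ℝ) • (g + h) : 𝓔.domain) : Lp ℝ (ENNReal.ofReal p) m) -
          (f : Lp ℝ (ENNReal.ofReal p) m) = (1 / 2 : ℝ) •
          (((g : Lp ℝ (ENNReal.ofReal p) m) - (f : Lp ℝ (ENNReal.ofReal p) m)) +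
           ((h : Lp ℝ (ENNReal.ofReal p) m) - (f : Lp ℝ (ENNReal.ofReal p) m))) := by
        push_cast
        module
      rw [e, norm_smul, Real.norm_of_nonneg (by norm_num)]
      linarith [norm_add_le
        ((g : Lp ℝ (ENNReal.ofReal p) m) - (f : Lp ℝ (ENNReal.ofReal p) m))
        ((h : Lp ℝ (ENNReal.ofReal p) m) - (f : Lp ℝ (ENNReal.ofReal p) m))]
  have hT_anti : ∀ {k n : ℕ}, n ≤ k → T k ⊆ T n := fun h g hg =>
    ⟨hg.1, hg.2.1, hg.2.2.trans (hδ_anti h)⟩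
  have hT_ne : ∀ n, (T n).Nonempty := fun n => hf _ (hδ n)
  let a : ℕ → ℝ := fun n => sInf (𝓔.energy '' T n)
  have hbdd : ∀ n, BddBelow (𝓔.energy '' T n) := fun n =>
    ⟨0, by rintro _ ⟨g, -, rfl⟩; exact 𝓔.energy_nonneg g⟩
  have ha_le : ∀ n, ∀ g ∈ T n, a n ≤ 𝓔.energy g := fun n g hg =>
    csInf_le (hbdd n) ⟨g, hg, rfl⟩
  have ha_nonneg : ∀ n, 0 ≤ a n := fun n =>
    Real.sInf_nonneg (by rintro _ ⟨g, -, rfl⟩; exact 𝓔.energy_nonneg g)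
  have ha_mono : Monotone a := fun n k h =>
    csInf_le_csInf (hbdd n) ((hT_ne k).image _) (Set.image_mono (hT_anti h))
  have ha_bdd : BddAbove (Set.range a) := by
    refine ⟨C ^ p, ?_⟩
    rintro _ ⟨n, rfl⟩
    obtain ⟨g, hg⟩ := hT_ne n
    exact (ha_le n g hg).trans (𝓔.energy_le_rpow hp hg.2.1)
  set A : ℝ := ⨆ n, a n
  have ha_lim : Tendsto a atTop (𝓝 A) := tendsto_atTop_ciSup ha_mono ha_bdd
  have hA : ∀ n, a n ≤ A := fun n => le_ciSup ha_bdd n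
  have hex : ∀ n, ∃ g ∈ T n, 𝓔.energy g < a n + δ n := fun n => by
    obtain ⟨_, ⟨g, hg, rfl⟩, h⟩ :=
      exists_lt_of_csInf_lt ((hT_ne n).image 𝓔.energy) (lt_add_of_pos_right (a n) (hδ n))
    exact ⟨g, hg, h⟩
  choose g hgT hgE using hex
  -- Bounds the energy of every `g j` with `j ≥ n`, since `a j ≤ A`. Midpoints stay in `T n` and so
  -- have energy at least `a n`, while `b n - a n` tends to `0`.
  let b : ℕ → ℝ := fun n => A + δ n
  let ρ : ℕ → ℝ := fun n =>
    max (b n - a n) ((b n ^ (1 / (p - 1)) - a n ^ (1 / (p - 1))) ^ (p - 1))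
  have hρ : Tendsto ρ atTop (𝓝 0) := by
    have hb : Tendsto b atTop (𝓝 A) := by simpa using hδ_lim.const_add A
    have hq : 0 ≤ 1 / (p - 1) := one_div_nonneg.2 (by linarith)
    have h1 := hb.sub ha_lim
    have h2 := ((hb.rpow_const (Or.inr hq)).sub (ha_lim.rpow_const (Or.inr hq))).rpow_const
      (p := p - 1) (Or.inr (by linarith))
    have h3 := h1.max h2
    rw [sub_self, sub_self, Real.zero_rpow (by linarith), max_self] at h3
    exact h3
  have hcauchy : ∀ n k l, n ≤ k → n ≤ l → 𝓔.seminorm (g k - g l) ≤ 2 * ρ n ^ (1 / p) := by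
    intro n k l hk hl
    have hk' := hT_anti hk (hgT k)
    have hl' := hT_anti hl (hgT l)
    have hle : ∀ j, n ≤ j → 𝓔.energy (g j) ≤ b n := fun j hj =>
      (hgE j).le.trans (add_le_add (hA j) (hδ_anti hj))
    have h1 := 𝓔.energy_half_sub_le hp (ha_nonneg n) (hle k hk) (hle l hl)
      (ha_le n _ (hT_mid n _ hk' _ hl'))
    have h2 : 𝓔.seminorm ((1 / 2 : ℝ) • (g k - g l)) ≤ ρ n ^ (1 / p) :=
      Real.rpow_le_rpow (𝓔.energy_nonneg _) h1 (by positivity)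
    rw [seminorm_smul, abs_of_pos (by norm_num)] at h2
    linarith
  have hlim : Tendsto (fun n => 2 * ρ n ^ (1 / p) + 2 * δ n) atTop (𝓝 0) := by
    have h1 := ((hρ.rpow_const (p := 1 / p) (Or.inr (by positivity))).const_mul 2).add
      (hδ_lim.const_mul 2)
    rw [Real.zero_rpow (by positivity)] at h1
    simpa using h1
  obtain ⟨G, hG⟩ := 𝓔.complete g (fun η hη => by
    obtain ⟨N, hN⟩ := (hlim.eventually (gt_mem_nhds hη)).exists
    refine ⟨N, fun k hk l hl => lt_of_le_of_lt (add_le_add (hcauchy N k l hk hl) ?_) hN⟩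
    have h1 := (hT_anti hk (hgT k)).2.2
    have h2 := (hT_anti hl (hgT l)).2.2
    have h3 := norm_sub_le
      ((g k : Lp ℝ (ENNReal.ofReal p) m) - (f : Lp ℝ (ENNReal.ofReal p) m))
      ((g l : Lp ℝ (ENNReal.ofReal p) m) - (f : Lp ℝ (ENNReal.ofReal p) m))
    rw [sub_sub_sub_cancel_right] at h3
    linarith)
  -- Membership in `T n` already forces `g n → f` in `L^p`, which identifies the limit.
  have hGf : G = f := by
    refine Subtype.ext (sub_eq_zero.1 (norm_le_zero_iff.1 (le_of_forall_pos_lt_add ?_)))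
    intro η hη
    obtain ⟨N, hN⟩ := hG (η / 2) (by positivity)
    obtain ⟨M, hM⟩ := (hδ_lim.eventually (gt_mem_nhds (half_pos hη))).exists
    have h1 := hN (max N M) (le_max_left _ _)
    have h2 := (hT_anti (le_max_right N M) (hgT (max N M))).2.2
    have h3 := norm_sub_le
      ((g (max N M) : Lp ℝ (ENNReal.ofReal p) m) - (f : Lp ℝ (ENNReal.ofReal p) m))
      ((g (max N M) : Lp ℝ (ENNReal.ofReal p) m) - (G : Lp ℝ (ENNReal.ofReal p) m))
    rw [sub_sub_sub_cancel_left] at h3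
    have h4 : 0 ≤ 𝓔.energy (g (max N M) - G) ^ (1 / p) := 𝓔.seminorm_nonneg _
    linarith
  subst hGf
  obtain ⟨N, hN⟩ := hG ε hε
  exact ⟨g N, (hgT N).1, hN N le_rfl⟩

/-! ### Truncations -/

lemma lipschitzWith_max_sub (c : ℝ) : LipschitzWith 1 fun t : ℝ => max (t - c) 0 :=
  have h : LipschitzWith 1 fun t : ℝ => t - c := LipschitzWith.of_dist_le_mul fun x y => by simp
  h.max_const 0

/-- The truncation `(f - c)⁺`, `0 ≤ c`, in the domain of the energy. -/
noncomputable def trunc {c : ℝ} (hc : 0 ≤ c) (f : 𝓔.domain) : 𝓔.domain :=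
  ⟨_, (𝓔.markov (fun t => max (t - c) 0) (by simpa using hc) (lipschitzWith_max_sub c) f).choose⟩

lemma seminorm_trunc_le (hp : 1 < p) {c : ℝ} (hc : 0 ≤ c) (f : 𝓔.domain) :
    𝓔.seminorm (𝓔.trunc hc f) ≤ 𝓔.seminorm f :=
  Real.rpow_le_rpow (𝓔.energy_nonneg _) (𝓔.markov (fun t => max (t - c) 0) (by simpa using hc)
    (lipschitzWith_max_sub c) f).choose_spec (by positivity)

lemma coeFn_trunc {c : ℝ} (hc : 0 ≤ c) (f : 𝓔.domain) :
    (𝓔.trunc hc f : Lp ℝ (ENNReal.ofReal p) m) =ᵐ[m]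
      fun x => max ((f : Lp ℝ (ENNReal.ofReal p) m) x - c) 0 :=
  LipschitzWith.coeFn_compLp (lipschitzWith_max_sub c) (by simpa using hc) _

/-- Truncation is 1-Lipschitz for the `L^p` norm. The Markov property gives no such estimate for the
energy of a difference, hence the recourse to the Mazur type lemma. -/
lemma norm_trunc_sub_le {c : ℝ} (hc : 0 ≤ c) (f g : 𝓔.domain) :
    ‖(𝓔.trunc hc f : Lp ℝ (ENNReal.ofReal p) m) - (𝓔.trunc hc g : Lp ℝ (ENNReal.ofReal p) m)‖ ≤
      ‖(f : Lp ℝ (ENNReal.ofReal p) m) - (g : Lp ℝ (ENNReal.ofReal p) m)‖ := by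
  have := (lipschitzWith_max_sub c).norm_compLp_sub_le (by simpa using hc)
    (f : Lp ℝ (ENNReal.ofReal p) m) (g : Lp ℝ (ENNReal.ofReal p) m)
  rwa [NNReal.coe_one, one_mul] at this

end PEnergy

/-! ### Operations on continuous compactly supported versions -/

section CcVersion

variable {X : Type*} [TopologicalSpace X] [MeasurableSpace X] {p : ℝ} {m : Measure X}

lemma IsCcVersion.add {q : ℝ≥0∞} {f g : Lp ℝ q m} {v w : X → ℝ} (hf : IsCcVersion f v)
    (hg : IsCcVersion g w) : IsCcVersion (f + g) fun x => v x + w x :=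
  ⟨⟨hf.1.1.add hg.1.1, hf.1.2.add hg.1.2⟩, (Lp.coeFn_add f g).trans (hf.2.add hg.2)⟩

lemma IsCcVersion.smul {q : ℝ≥0∞} {f : Lp ℝ q m} {v : X → ℝ} (c : ℝ) (hf : IsCcVersion f v) :
    IsCcVersion (c • f) fun x => c * v x :=
  ⟨⟨hf.1.1.const_mul c, hf.1.2.mul_left⟩, (Lp.coeFn_smul c f).trans (hf.2.const_smul c)⟩

lemma IsCcVersion.sub {q : ℝ≥0∞} {f g : Lp ℝ q m} {v w : X → ℝ} (hf : IsCcVersion f v)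
    (hg : IsCcVersion g w) : IsCcVersion (f - g) fun x => v x - w x := by
  have := hf.add (hg.smul (-1))
  simpa [← sub_eq_add_neg] using this

lemma IsCcVersion.trunc {𝓔 : PEnergy p m} {f : 𝓔.domain} {v : X → ℝ} {c : ℝ} (hc : 0 ≤ c)
    (hf : IsCcVersion (f : Lp ℝ (ENNReal.ofReal p) m) v) :
    IsCcVersion (𝓔.trunc hc f : Lp ℝ (ENNReal.ofReal p) m) fun x => max (v x - c) 0 := by
  refine ⟨⟨by have := hf.1.1; fun_prop, ?_⟩, (𝓔.coeFn_trunc hc f).trans ?_⟩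
  · exact hf.1.2.comp_left (g := fun t => max (t - c) 0) (by simpa using hc)
  · filter_upwards [hf.2] with x hx
    rw [hx]

lemma IsCcVersion.zero {q : ℝ≥0∞} : IsCcVersion (0 : Lp ℝ q m) fun _ => 0 :=
  ⟨⟨continuous_const, HasCompactSupport.zero⟩, Lp.coeFn_zero ℝ q m⟩

end CcVersion

/-! ### Approximation near compact sets -/

namespace PEnergy

variable {X : Type*} [MetricSpace X] [MeasurableSpace X] {p : ℝ}
  {m : Measure X} (𝓔 : PEnergy p m)

/-- Between a compact set and an open set there is a continuous cutoff function in `𝓕`. -/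
lemma exists_cutoff [LocallyCompactSpace X] {K B : Set X}
    (hK : IsCompact K) (hB : IsOpen B) (hKB : K ⊆ B) :
    ∃ (χ : 𝓔.domain) (v : X → ℝ), IsCcVersion (χ : Lp ℝ (ENNReal.ofReal p) m) v ∧
      (∀ x ∈ K, 1 / 2 ≤ v x) ∧ (∀ x, v x ≤ 1) ∧ ∀ x ∉ B, v x ≤ 0 := by
  obtain ⟨ψ, h1, h0, hc, hI⟩ := exists_continuous_one_zero_of_isCompact hK hB.isClosed_compl
    (Set.disjoint_compl_right_iff_subset.2 hKB)
  -- With uniform error `1 / 4`, subtracting `1 / 4` and taking the positive part leaves values at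
  -- least `1 / 2` on `K`, at most `1` everywhere, and `0` off `B`.
  obtain ⟨f, v, hv, happ⟩ := 𝓔.regular_uniform ψ ⟨ψ.continuous, hc⟩ (1 / 4) (by norm_num)
  refine ⟨_, _, hv.trunc (c := 1 / 4) (by norm_num), fun x hx => ?_, fun x => ?_, fun x hx => ?_⟩
  · have e : ψ x = 1 := h1 hx
    have := abs_le.1 (happ x)
    exact le_max_of_le_left (by linarith)
  · have := abs_le.1 (happ x)
    exact max_le (by linarith [(hI x).2]) zero_le_one
  · have e : ψ x = 0 := h0 hx
    have := abs_le.1 (happ x)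
    exact max_le (by linarith) le_rfl

/-- A function `u ∈ 𝓕` with `u ≥ 1` on a neighbourhood of a compact set `K` gives rise to
elements of `𝓕 ∩ C_c(X)` of nearly the same norm or smaller which are at least `1 / 2` on `K`. -/
lemma exists_ccVersion_of_one_le [LocallyCompactSpace X] [Fact (1 ≤ ENNReal.ofReal p)]
    (hp : 1 < p) {K B : Set X} (hK : IsCompact K) (hB : IsOpen B) (hKB : K ⊆ B) {u : 𝓔.domain}
    (hu : ∀ᵐ x ∂m, x ∈ B → 1 ≤ (u : Lp ℝ (ENNReal.ofReal p) m) x) {ε : ℝ} (hε : 0 < ε) :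
    ∃ (g : 𝓔.domain) (v : X → ℝ), IsCcVersion (g : Lp ℝ (ENNReal.ofReal p) m) v ∧
      (∀ x ∈ K, 1 / 2 ≤ v x) ∧ 𝓔.seminorm g + ‖(g : Lp ℝ (ENNReal.ofReal p) m)‖ <
        𝓔.seminorm u + ‖(u : Lp ℝ (ENNReal.ofReal p) m)‖ + ε := by
  obtain ⟨χ, w, hw, hwK, hw1, hw0⟩ := 𝓔.exists_cutoff hK hB hKB
  set f := 𝓔.trunc le_rfl u
  -- The cutoff lies below `f = u⁺` almost everywhere, so `max f χ = f`.
  have hf : 𝓔.trunc le_rfl (χ - f) = 0 := by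
    refine Subtype.ext (Lp.ext ((𝓔.coeFn_trunc le_rfl (χ - f)).trans ?_))
    filter_upwards [hu, 𝓔.coeFn_trunc le_rfl u, hw.2,
      Lp.coeFn_sub (χ : Lp ℝ (ENNReal.ofReal p) m) (f : Lp ℝ (ENNReal.ofReal p) m),
      Lp.coeFn_zero ℝ (ENNReal.ofReal p) m] with x hx1 hx2 hx3 hx4 hx5
    rw [Submodule.coe_sub, hx4, Pi.sub_apply, hx3, hx2, Submodule.coe_zero, hx5, Pi.zero_apply]
    refine max_eq_right ?_
    by_cases hxB : x ∈ B
    · have := le_max_left ((u : Lp ℝ (ENNReal.ofReal p) m) x - 0) 0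
      linarith [hw1 x, hx1 hxB]
    · have := le_max_right ((u : Lp ℝ (ENNReal.ofReal p) m) x - 0) 0
      linarith [hw0 x hxB]
  let S : Set 𝓔.domain := {g | ∃ v : X → ℝ, IsCcVersion (g : Lp ℝ (ENNReal.ofReal p) m) v ∧
    ∀ x ∈ K, 1 / 2 ≤ v x}
  have hS : ∀ g ∈ S, ∀ h ∈ S, (1 / 2 : ℝ) • (g + h) ∈ S := by
    rintro g ⟨v, hv, hvK⟩ h ⟨v', hv', hvK'⟩
    exact ⟨_, (hv.add hv').smul (1 / 2), fun x hx => by linarith [hvK x hx, hvK' x hx]⟩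
  obtain ⟨g, ⟨v, hv, hvK⟩, hgf⟩ := 𝓔.exists_mem_seminorm_add_norm_lt hp hS
    (C := 2 * (𝓔.seminorm f + 1) + 𝓔.seminorm χ) (f := f) (fun η hη => by
      obtain ⟨h, v, hv, hhf⟩ := 𝓔.regular_energy f (min 1 (η / 2)) (by positivity)
      have hhf1 : 𝓔.seminorm (f - h) + _ < _ := hhf
      have h1 := hhf1.trans_le (min_le_left _ _)
      have h2 := hhf1.trans_le (min_le_right _ _)
      -- This is `max h χ`: continuous, at least `χ ≥ 1 / 2` on `K`, and `L^p`-close to `max f χ =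
      -- f` when `h` is close to `f`. The bound `1` in the choice of `h` gives the energy constant,
      -- the bound `η / 2` the `L^p` error.
      refine ⟨h + 𝓔.trunc le_rfl (χ - h), ⟨_, hv.add ((hw.sub hv).trunc le_rfl), ?_⟩, ?_, ?_⟩
      · intro x hx
        have := le_max_left (w x - v x - 0) 0
        linarith [hwK x hx]
      · have e1 := 𝓔.seminorm_add_le h (𝓔.trunc le_rfl (χ - h))
        have e2 := 𝓔.seminorm_trunc_le hp le_rfl (χ - h)
        have e3 := 𝓔.seminorm_sub_le χ h
        have e4 := 𝓔.seminorm_sub_le f (f - h)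
        rw [sub_sub_cancel] at e4
        have e5 := norm_nonneg ((f : Lp ℝ (ENNReal.ofReal p) m) - h)
        linarith
      · have e1 := 𝓔.norm_trunc_sub_le le_rfl (χ - h) (χ - f)
        rw [hf, Submodule.coe_sub, Submodule.coe_sub, sub_sub_sub_cancel_left,
          Submodule.coe_zero, sub_zero] at e1
        have e2 := norm_add_le ((h : Lp ℝ (ENNReal.ofReal p) m) - f)
          (𝓔.trunc le_rfl (χ - h) : Lp ℝ (ENNReal.ofReal p) m)
        have e3 := norm_sub_rev (h : Lp ℝ (ENNReal.ofReal p) m) f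
        have e4 := 𝓔.seminorm_nonneg (f - h)
        rw [Submodule.coe_add, add_sub_right_comm]
        linarith) hε
  refine ⟨g, v, hv, hvK, ?_⟩
  have e1 := 𝓔.seminorm_add_le (g - f) f
  rw [sub_add_cancel] at e1
  have e2 := norm_add_le ((g : Lp ℝ (ENNReal.ofReal p) m) - f) f
  rw [sub_add_cancel] at e2
  have e3 := 𝓔.seminorm_trunc_le hp le_rfl u
  have e4 := 𝓔.norm_trunc_sub_le le_rfl u 0
  have e5 : 𝓔.trunc le_rfl (0 : 𝓔.domain) = 0 := by
    refine Subtype.ext (Lp.ext ((𝓔.coeFn_trunc le_rfl 0).trans ?_))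
    filter_upwards [Lp.coeFn_zero ℝ (ENNReal.ofReal p) m] with x hx
    rw [Submodule.coe_zero, hx]
    simp
  rw [e5, Submodule.coe_zero, sub_zero, sub_zero] at e4
  linarith

/-- If a compact set `K` has zero capacity, elements of `𝓕 ∩ C_c(X)` are limits in `𝓕` of elements
of `𝓕 ∩ C_c(X)` that vanish on `K`. -/
lemma exists_ccVersion_eq_zero [LocallyCompactSpace X] [Fact (1 ≤ ENNReal.ofReal p)]
    (hp : 1 < p) {K : Set X} (hK : IsCompact K) (hcap : 𝓔.capOne K = 0)
    {f : 𝓔.domain} {v : X → ℝ} (hv : IsCcVersion (f : Lp ℝ (ENNReal.ofReal p) m) v) {ε : ℝ}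
    (hε : 0 < ε) :
    ∃ (g : 𝓔.domain) (w : X → ℝ), IsCcVersion (g : Lp ℝ (ENNReal.ofReal p) m) w ∧
      (∀ x ∈ K, w x = 0) ∧ 𝓔.seminorm (g - f) < ε := by
  have hp0 : 0 < p := by linarith
  obtain ⟨M₀, hM₀⟩ := hv.1.2.exists_bound_of_continuous hv.1.1
  -- The factor `2` offsets the `1 / 2`: if `w ≥ 1 / 2` on `K`, then `M * w ≥ |v|` there.
  set M : ℝ := 2 * max M₀ 0
  have hM : 0 ≤ M := by positivity
  have hMv : ∀ x, |v x| ≤ M / 2 := fun x => by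
    have := (hM₀ x).trans (le_max_left M₀ 0)
    rw [Real.norm_eq_abs] at this
    simpa [M] using this
  let S : Set 𝓔.domain := {g | ∃ w : X → ℝ, IsCcVersion (g : Lp ℝ (ENNReal.ofReal p) m) w ∧
    ∀ x ∈ K, w x = 0}
  have hS : ∀ g ∈ S, ∀ h ∈ S, (1 / 2 : ℝ) • (g + h) ∈ S := by
    rintro g ⟨v, hv, hvK⟩ h ⟨v', hv', hvK'⟩
    exact ⟨_, (hv.add hv').smul (1 / 2), fun x hx => by rw [hvK x hx, hvK' x hx]; ring⟩
  have hsmall : ∀ η > 0, ∃ (h : 𝓔.domain) (w : X → ℝ),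
      IsCcVersion (h : Lp ℝ (ENNReal.ofReal p) m) w ∧ (∀ x ∈ K, 1 / 2 ≤ w x) ∧
      𝓔.seminorm h + ‖(h : Lp ℝ (ENNReal.ofReal p) m)‖ < η := by
    intro η hη
    -- One third of `η` each for the semi-norm of `u`, its `L^p` norm, and the passage to a
    -- continuous function.
    have hlt : 𝓔.capOne K < ENNReal.ofReal ((η / 3) ^ p) := by
      rw [hcap]
      exact ENNReal.ofReal_pos.2 (by positivity)
    simp only [capOne, capOneOpen, iInf_lt_iff] at hlt
    obtain ⟨B, hB, hKB, u, hu, hlt⟩ := hlt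
    have h1 : 𝓔.energy u + ‖(u : Lp ℝ (ENNReal.ofReal p) m)‖ ^ p < (η / 3) ^ p :=
      (ENNReal.ofReal_lt_ofReal_iff (by positivity)).1 hlt
    have h2 := 𝓔.energy_nonneg u
    have h3 : 0 ≤ ‖(u : Lp ℝ (ENNReal.ofReal p) m)‖ ^ p := by positivity
    rw [← 𝓔.seminorm_rpow hp] at h1 h2
    have h4 : 𝓔.seminorm u < η / 3 :=
      (Real.rpow_lt_rpow_iff (𝓔.seminorm_nonneg u) (by positivity) hp0).1 (by linarith)
    have h5 : ‖(u : Lp ℝ (ENNReal.ofReal p) m)‖ < η / 3 :=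
      (Real.rpow_lt_rpow_iff (norm_nonneg _) (by positivity) hp0).1 (by linarith)
    obtain ⟨h, w, hw, hwK, hlt'⟩ := 𝓔.exists_ccVersion_of_one_le hp hK hB hKB hu
      (ε := η / 3) (by positivity)
    exact ⟨h, w, hw, hwK, by linarith⟩
  have hdecomp : 𝓔.trunc le_rfl f - 𝓔.trunc le_rfl ((-1 : ℝ) • f) = f := by
    refine Subtype.ext (Lp.ext ?_)
    rw [Submodule.coe_sub]
    filter_upwards [Lp.coeFn_sub (𝓔.trunc le_rfl f : Lp ℝ (ENNReal.ofReal p) m)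
      (𝓔.trunc le_rfl ((-1 : ℝ) • f) : Lp ℝ (ENNReal.ofReal p) m), 𝓔.coeFn_trunc le_rfl f,
      𝓔.coeFn_trunc le_rfl ((-1 : ℝ) • f),
      Lp.coeFn_smul (-1 : ℝ) (f : Lp ℝ (ENNReal.ofReal p) m)] with x h1 h2 h3 h4
    rw [h1, Pi.sub_apply, h2, h3, Submodule.coe_smul, h4, Pi.smul_apply, sub_zero, sub_zero,
      neg_one_smul]
    exact max_zero_sub_max_neg_zero_eq_self _
  obtain ⟨g, ⟨w, hw, hwK⟩, hgf⟩ := 𝓔.exists_mem_seminorm_add_norm_lt hp hS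
    (C := 2 * (𝓔.seminorm f + M * 1)) (f := f) (fun η hη => by
      obtain ⟨h, w, hw, hwK, hlt⟩ := hsmall (min 1 (η / (2 * (M + 1)))) (by positivity)
      have hh1 : 𝓔.seminorm h ≤ 1 := by
        linarith [hlt.trans_le (min_le_left _ _), norm_nonneg (h : Lp ℝ (ENNReal.ofReal p) m)]
      have hh2 : ‖(h : Lp ℝ (ENNReal.ofReal p) m)‖ ≤ η / (2 * (M + 1)) := by
        linarith [hlt.trans_le (min_le_right _ _), 𝓔.seminorm_nonneg h]
      have hh3 : M * ‖(h : Lp ℝ (ENNReal.ofReal p) m)‖ ≤ η / 2 := by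
        calc M * ‖(h : Lp ℝ (ENNReal.ofReal p) m)‖ ≤ (M + 1) * (η / (2 * (M + 1))) := by
              gcongr; linarith
          _ = η / 2 := by field_simp
      -- Soft thresholding of `f` at height `M • h`: both positive parts vanish on `K`, and by
      -- `hdecomp` removing `M • h` gives back `f`.
      refine ⟨𝓔.trunc le_rfl (f - M • h) - 𝓔.trunc le_rfl ((-1 : ℝ) • f - M • h),
        ⟨_, ((hv.sub (hw.smul M)).trunc le_rfl).sub
          (((hv.smul (-1)).sub (hw.smul M)).trunc le_rfl), fun x hx => ?_⟩, ?_, ?_⟩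
      · have h1 := abs_le.1 (hMv x)
        have h2 := mul_le_mul_of_nonneg_left (hwK x hx) hM
        rw [max_eq_right (by linarith), max_eq_right (by linarith), sub_zero]
      · have bound : ∀ k, 𝓔.seminorm k = 𝓔.seminorm f →
            𝓔.seminorm (𝓔.trunc le_rfl (k - M • h)) ≤ 𝓔.seminorm f + M * 1 := fun k hk => by
          have e1 := 𝓔.seminorm_trunc_le hp le_rfl (k - M • h)
          have e2 := 𝓔.seminorm_sub_le k (M • h)
          rw [seminorm_smul, abs_of_nonneg hM] at e2
          have e3 := mul_le_mul_of_nonneg_left hh1 hM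
          linarith
        have e1 := 𝓔.seminorm_sub_le (𝓔.trunc le_rfl (f - M • h))
          (𝓔.trunc le_rfl ((-1 : ℝ) • f - M • h))
        linarith [bound f rfl, bound ((-1 : ℝ) • f) (by rw [seminorm_smul]; simp)]
      · have bound : ∀ k, ‖(𝓔.trunc le_rfl (k - M • h) : Lp ℝ (ENNReal.ofReal p) m) -
            𝓔.trunc le_rfl k‖ ≤ η / 2 := fun k => by
          refine (𝓔.norm_trunc_sub_le le_rfl _ _).trans ?_
          rw [Submodule.coe_sub, sub_sub_cancel_left, norm_neg, Submodule.coe_smul, norm_smul,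
            Real.norm_of_nonneg hM]
          exact hh3
        have e : (f : Lp ℝ (ENNReal.ofReal p) m) = 𝓔.trunc le_rfl f -
            𝓔.trunc le_rfl ((-1 : ℝ) • f) := by rw [← Submodule.coe_sub, hdecomp]
        rw [Submodule.coe_sub, e, sub_sub_sub_comm]
        refine (norm_sub_le _ _).trans ?_
        linarith [bound f, bound ((-1 : ℝ) • f)]) hε
  exact ⟨g, w, hw, hwK, by linarith [norm_nonneg ((g : Lp ℝ (ENNReal.ofReal p) m) - f)]⟩

/-! ### Sets of zero capacity -/

lemma capOne_mono {A A' : Set X} (h : A ⊆ A') : 𝓔.capOne A ≤ 𝓔.capOne A' :=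
  le_iInf₂ fun B hB => le_iInf fun hA' => iInf₂_le_of_le B hB (iInf_le _ (h.trans hA'))

/-- A set of zero capacity is contained in a Borel set of zero capacity. -/
lemma exists_measurableSet_superset_capOne_eq_zero [BorelSpace X] {A : Set X}
    (hA : 𝓔.capOne A = 0) :
    ∃ G, A ⊆ G ∧ MeasurableSet G ∧ 𝓔.capOne G = 0 := by
  have hex : ∀ n : ℕ, ∃ B, IsOpen B ∧ A ⊆ B ∧ 𝓔.capOneOpen B < ((n : ℝ≥0∞) + 1)⁻¹ := fun n => by
    have : 𝓔.capOne A < ((n : ℝ≥0∞) + 1)⁻¹ := by rw [hA]; simp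
    simp only [capOne, iInf_lt_iff] at this
    obtain ⟨B, hB, hAB, h⟩ := this
    exact ⟨B, hB, hAB, h⟩
  choose B hB hAB hlt using hex
  refine ⟨⋂ n, B n, Set.subset_iInter hAB, MeasurableSet.iInter fun n => (hB n).measurableSet, ?_⟩
  refine le_antisymm (ENNReal.le_of_forall_pos_le_add fun ε hε _ => ?_) zero_le
  obtain ⟨n, hn⟩ := ENNReal.exists_inv_nat_lt (ENNReal.coe_pos.2 hε).ne'
  rw [zero_add]
  calc 𝓔.capOne (⋂ n, B n) ≤ 𝓔.capOneOpen (B n) :=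
        iInf₂_le_of_le (B n) (hB n) (iInf_le _ (Set.iInter_subset B n))
    _ ≤ ((n : ℝ≥0∞) + 1)⁻¹ := (hlt n).le
    _ ≤ (n : ℝ≥0∞)⁻¹ := by gcongr; exact le_self_add
    _ ≤ ε := hn.le

/-! ### Energy measures on sets of zero capacity -/

namespace IsEnergyMeasure

variable {𝓔} {Γ : 𝓔.domain → Measure X}

lemma isFiniteMeasure (hΓ : 𝓔.IsEnergyMeasure Γ) (f : 𝓔.domain) : IsFiniteMeasure (Γ f) :=
  ⟨by rw [hΓ.total_mass]; exact ENNReal.ofReal_lt_top⟩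

lemma real_rpow_le_seminorm (hΓ : 𝓔.IsEnergyMeasure Γ) (hp : 1 < p) (f : 𝓔.domain) (A : Set X) :
    (Γ f).real A ^ (1 / p) ≤ 𝓔.seminorm f := by
  have := hΓ.isFiniteMeasure f
  refine Real.rpow_le_rpow measureReal_nonneg ?_ (by positivity)
  calc (Γ f).real A ≤ (Γ f).real Set.univ := measureReal_mono (Set.subset_univ A)
    _ = 𝓔.energy f := by
      rw [measureReal_def, hΓ.total_mass, ENNReal.toReal_ofReal (𝓔.energy_nonneg f)]

/-- The energy measures of limits in `𝓕` do not charge a set that is not charged by the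
approximating energy measures. -/
lemma measure_eq_zero_of_approx (hΓ : 𝓔.IsEnergyMeasure Γ) (hp : 1 < p) {A : Set X}
    (hA : MeasurableSet A) {f : 𝓔.domain}
    (h : ∀ ε > 0, ∃ g, Γ g A = 0 ∧ 𝓔.seminorm (g - f) < ε) : Γ f A = 0 := by
  have := hΓ.isFiniteMeasure f
  have hp' : 1 / p ≠ 0 := by positivity
  have h0 : (Γ f).real A ^ (1 / p) ≤ 0 := le_of_forall_pos_le_add fun ε hε => by
    obtain ⟨g, hg, hlt⟩ := h ε hε
    have e1 := hΓ.add_le A hA g (f - g)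
    rw [add_sub_cancel, measureReal_def (Γ g), hg, ENNReal.toReal_zero,
      Real.zero_rpow hp'] at e1
    have e2 := hΓ.real_rpow_le_seminorm hp (f - g) A
    rw [← 𝓔.seminorm_neg, neg_sub] at e2
    linarith
  have h1 := (Real.rpow_eq_zero measureReal_nonneg hp').1
    (le_antisymm h0 (Real.rpow_nonneg measureReal_nonneg _))
  exact (measureReal_eq_zero_iff).1 h1

/-- Two approximations are chained: `f` by elements of `𝓕 ∩ C_c(X)`, and each of these by elements
of `𝓕 ∩ C_c(X)` vanishing on `K`, whose energy measures agree on `K` with `Γ 0 = 0` by locality. -/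
lemma measure_eq_zero_of_isCompact [LocallyCompactSpace X] [BorelSpace X]
    (hΓ : 𝓔.IsEnergyMeasure Γ) (hp : 1 < p) {K : Set X} (hK : IsCompact K)
    (hcap : 𝓔.capOne K = 0) (f : 𝓔.domain) : Γ f K = 0 := by
  have : Fact (1 ≤ ENNReal.ofReal p) := ⟨by simpa using hp.le⟩
  refine hΓ.measure_eq_zero_of_approx hp hK.measurableSet fun ε hε => ?_
  obtain ⟨g, v, hv, hlt⟩ := 𝓔.regular_energy f ε hε
  refine ⟨g, hΓ.measure_eq_zero_of_approx hp hK.measurableSet fun δ hδ => ?_, ?_⟩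
  · obtain ⟨h, w, hw, hwK, hh⟩ := 𝓔.exists_ccVersion_eq_zero hp hK hcap hv hδ
    refine ⟨h, ?_, hh⟩
    rw [hΓ.locality h 0 w _ hw IsCcVersion.zero K hK.measurableSet
      ⟨0, fun x hx => by rw [hwK x hx, sub_zero]⟩]
    refine measure_mono_null (Set.subset_univ K) ?_
    rw [hΓ.total_mass, 𝓔.energy_zero hp, ENNReal.ofReal_zero]
  · have e : 𝓔.seminorm (f - g) + _ < ε := hlt
    rw [← 𝓔.seminorm_neg, neg_sub] at e
    linarith [norm_nonneg ((f : Lp ℝ (ENNReal.ofReal p) m) - g)]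

end IsEnergyMeasure

end PEnergy

/-- The `p`-energy measure `Γ(u)` charges no set of zero capacity: for an arbitrary subset `A`,
`Γ(u)(A) = 0` means that `A` is contained in a Borel set of `Γ(u)`-measure zero. -/
theorem proposition8p11 {X : Type*} [MetricSpace X] [LocallyCompactSpace X]
    [TopologicalSpace.SeparableSpace X] [MeasurableSpace X] [BorelSpace X]
    (m : Measure X) [m.Regular] [m.IsOpenPosMeasure] (p : ℝ) (hp : 1 < p)
    (𝓔 : PEnergy p m) (Γ : 𝓔.domain → Measure X) (hΓ : 𝓔.IsEnergyMeasure Γ)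
    (u : 𝓔.domain) (A : Set X) (hA : 𝓔.capOne A = 0) :
    Γ u A = 0 := by
  obtain ⟨G, hAG, hG, hcap⟩ := 𝓔.exists_measurableSet_superset_capOne_eq_zero hA
  have := hΓ.isFiniteMeasure u
  have := hΓ.regular u
  refine measure_mono_null hAG ?_
  -- Compactness is what makes cutoffs in `C_c(X)` available, and capacity zero passes to compact
  -- subsets by monotonicity.
  rw [hG.measure_eq_iSup_isCompact_of_ne_top (measure_ne_top _ _)]
  refine le_antisymm (iSup₂_le fun K hKG => iSup_le fun hK => ?_) zero_le
  refine (hΓ.measure_eq_zero_of_isCompact hp hK ?_ u).le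
  exact le_antisymm ((𝓔.capOne_mono hKG).trans hcap.le) zero_le
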